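/- Let $n \ge 2$ and let $\mathcal{T}_n = \{\, x_i + x_j = 0 \mid 1 \le i < j \le n \,\}$ be the threshold arrangement of hyperplanes in $\mathbb{R}^n$. For a finite arrangement $\mathcal{A}$ of affine hyperplanes in $\mathbb{R}^n$, let $L(\mathcal{A})$ be the poset of flats (nonempty intersections of some of the hyperplanes of $\mathcal{A}$, including $\mathbb{R}^n$ as the empty intersection), ordered by reverse inclusion, with least element $\hat 0 = \mathbb{R}^n$ and Möbius function $\mu$, and let $$\chi_{\mathcal{A}}(t) = \sum_{x \in L(\mathcal{A})} \mu(\hat 0, x)\, t^{\dim x}$$ be the characteristic polynomial of $\mathcal{A}$. Then $$\chi_{\mathcal{T}_n}(t) = \sum_{k=1}^{n} \bigl(S(n,k) + n\, S(n-1,k)\bigr) \prod_{i=1}^{k} \bigl(t - (2i-1)\bigr),$$ where $S(m,k)$ denotes the Stirling number of the second kind, i.e. the number of partitions of an $m$-element set into $k$ nonempty blocks. -/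

import Mathlib

open Polynomial

/-- The affine hyperplane `{x ∈ ℝⁿ | a₁ x₁ + ⋯ + aₙ xₙ = b}` (a genuine hyperplane when `a ≠ 0`). -/
def affineHyperplane {n : ℕ} (a : Fin n → ℝ) (b : ℝ) : AffineSubspace ℝ (Fin n → ℝ) where
  carrier := {x | a ⬝ᵥ x = b}
  smul_vsub_vadd_mem' := by
    intro c p₁ p₂ p₃ h₁ h₂ h₃
    simp only [Set.mem_ofPred_eq] at h₁ h₂ h₃ ⊢
    simp [dotProduct_add, dotProduct_smul, dotProduct_sub, h₁, h₂, h₃]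

/-- A hyperplane arrangement in `ℝⁿ`: a finite collection of affine hyperplanes. -/
structure HyperplaneArrangement (n : ℕ) where
  hyperplanes : Set (AffineSubspace ℝ (Fin n → ℝ))
  finite : hyperplanes.Finite
  isHyperplane : ∀ H ∈ hyperplanes, ∃ (a : Fin n → ℝ) (b : ℝ), a ≠ 0 ∧ H = affineHyperplane a b

namespace HyperplaneArrangement

variable {n : ℕ}

/-- A flat is a nonempty intersection of some of the hyperplanes; the intersection of no
hyperplanes is the whole space `⊤`. -/
def IsFlat (A : HyperplaneArrangement n) (F : AffineSubspace ℝ (Fin n → ℝ)) : Prop :=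
  (F : Set (Fin n → ℝ)).Nonempty ∧ ∃ S ⊆ A.hyperplanes, F = sInf S

/-- The intersection poset: the flats, ordered by reverse inclusion. -/
abbrev IntersectionPoset (A : HyperplaneArrangement n) : Type :=
  {F : AffineSubspace ℝ (Fin n → ℝ) // A.IsFlat F}ᵒᵈ

/-- The flat underlying an element of the intersection poset. -/
def IntersectionPoset.flat {A : HyperplaneArrangement n} (x : A.IntersectionPoset) :
    AffineSubspace ℝ (Fin n → ℝ) :=
  (OrderDual.ofDual x).1

theorem isFlat_top (A : HyperplaneArrangement n) : A.IsFlat ⊤ :=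
  ⟨⟨0, by simp⟩, ∅, Set.empty_subset _, by simp⟩

theorem finite_isFlat (A : HyperplaneArrangement n) : {F | A.IsFlat F}.Finite := by
  refine (A.finite.finite_subsets.image sInf).subset ?_
  rintro F ⟨-, S, hS, rfl⟩
  exact ⟨S, hS, rfl⟩

/-- The least element of the intersection poset is the whole space. -/
instance (A : HyperplaneArrangement n) : OrderBot A.IntersectionPoset where
  bot := OrderDual.toDual ⟨⊤, A.isFlat_top⟩
  bot_le x := show (OrderDual.ofDual x).1 ≤ ⊤ from le_top

noncomputable instance (A : HyperplaneArrangement n) : Fintype A.IntersectionPoset :=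
  letI : Fintype {F : AffineSubspace ℝ (Fin n → ℝ) // A.IsFlat F} := A.finite_isFlat.fintype
  inferInstance

noncomputable instance (A : HyperplaneArrangement n) : DecidableEq A.IntersectionPoset :=
  Classical.decEq _

open Classical in
noncomputable instance (A : HyperplaneArrangement n) : LocallyFiniteOrder A.IntersectionPoset :=
  Fintype.toLocallyFiniteOrder

/-- The characteristic polynomial `∑ₓ μ(0̂, x) t ^ dim x`, the sum running over the intersection
poset, with `μ` its Möbius function. -/
noncomputable def charPoly (A : HyperplaneArrangement n) : ℤ[X] :=
  ∑ x : A.IntersectionPoset,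
    C (IncidenceAlgebra.mu ℤ ⊥ x) * X ^ Module.finrank ℝ x.flat.direction

end HyperplaneArrangement

/-- The hyperplane `x_i + x_j = 0` in `ℝⁿ`. -/
def sumZeroHyperplane {n : ℕ} (i j : Fin n) : AffineSubspace ℝ (Fin n → ℝ) :=
  affineHyperplane (Pi.single i 1 + Pi.single j 1) 0

theorem mem_sumZeroHyperplane {n : ℕ} (i j : Fin n) (x : Fin n → ℝ) :
    x ∈ sumZeroHyperplane i j ↔ x i + x j = 0 := by
  change (Pi.single i 1 + Pi.single j 1 : Fin n → ℝ) ⬝ᵥ x = 0 ↔ _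
  simp [add_dotProduct]

/-- The threshold arrangement `{x_i + x_j = 0 | 1 ≤ i < j ≤ n}` in `ℝⁿ`. -/
def thresholdArrangement (n : ℕ) : HyperplaneArrangement n where
  hyperplanes := {H | ∃ i j : Fin n, i < j ∧ H = sumZeroHyperplane i j}
  finite := by
    refine (Set.finite_range fun p : Fin n × Fin n => sumZeroHyperplane p.1 p.2).subset ?_
    rintro H ⟨i, j, -, rfl⟩
    exact ⟨(i, j), rfl⟩
  isHyperplane := by
    rintro H ⟨i, j, hij, rfl⟩
    refine ⟨Pi.single i 1 + Pi.single j 1, 0, fun h => ?_, rfl⟩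
    have := congrFun h i
    simp [hij.ne] at this

/-!
The characteristic polynomial is evaluated at every odd number `2 * m + 1` by counting integer
points, in the manner of the finite field method.

Let `B = {-m, …, m}`. Flats of the threshold arrangement are cut out by equations
`x i + x j = 0`, so on such a flat some of the coordinates are free and every other one is `0` or
`±` a free one (`IsSignedCoordinateSet`). As `B` contains `0` and is closed under negation, a flat
of dimension `d` has exactly `|B| ^ d` points in the cube `B ^ n` (`card_filter_mem_flat`). Möbius
inversion over the intersection poset (`HyperplaneArrangement.sum_mu_mul_card_filter_mem`) turns
this into `eval_charPoly_thresholdArrangement`: the value of the characteristic polynomial at `|B|`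
is the number of tuples in `B ^ n` that lie on none of the hyperplanes.

Such a tuple has at most one entry `0`, and deleting it leaves a tuple of nonzero numbers without
opposite entries (`card_filter_pairwise_add_ne_zero`). Tuples of the latter kind are counted by
their number `k` of distinct entries. Prepending an entry either repeats one of the `k` values or
picks one of the `2 * m - 2 * k` values that are still available; this is the recursion of
`S(n, k) * ∏ i < k, (2 * m - 2 * i)` (`sum_antipodeFree_card_image`). The two polynomials thus
agree at infinitely many points.
-/

/-! ### Möbius inversion over the intersection poset -/

theorem affineHyperplane_ne_top {n : ℕ} {a : Fin n → ℝ} (ha : a ≠ 0) (b : ℝ) :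
    affineHyperplane a b ≠ ⊤ := by
  intro h
  have h0 : a ⬝ᵥ (0 : Fin n → ℝ) = b :=
    show (0 : Fin n → ℝ) ∈ affineHyperplane a b from h ▸ AffineSubspace.mem_top ..
  have h1 : a ⬝ᵥ a = b := show a ∈ affineHyperplane a b from h ▸ AffineSubspace.mem_top ..
  rw [dotProduct_zero] at h0
  exact ha (dotProduct_self_eq_zero.1 (h1.trans h0.symm))

namespace HyperplaneArrangement

variable {n : ℕ} (A : HyperplaneArrangement n)

/-- The smallest flat containing `p`: the intersection of all hyperplanes through `p`. -/
def flatAt (p : Fin n → ℝ) : A.IntersectionPoset :=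
  OrderDual.toDual ⟨sInf {H ∈ A.hyperplanes | p ∈ H},
    ⟨p, (AffineSubspace.mem_sInf_iff ..).2 fun _ hH => hH.2⟩, _, Set.sep_subset _ _, rfl⟩

theorem le_flatAt_iff (p : Fin n → ℝ) (x : A.IntersectionPoset) :
    x ≤ A.flatAt p ↔ p ∈ x.flat := by
  change sInf {H ∈ A.hyperplanes | p ∈ H} ≤ x.flat ↔ _
  constructor
  · exact fun h => h ((AffineSubspace.mem_sInf_iff ..).2 fun _ hH => hH.2)
  · intro hp
    obtain ⟨S, hS, hx⟩ := (OrderDual.ofDual x).2.2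
    change x.flat = sInf S at hx
    rw [hx] at hp ⊢
    exact sInf_le_sInf fun H hH => ⟨hS hH, (AffineSubspace.mem_sInf_iff ..).1 hp H hH⟩

theorem bot_eq_flatAt_iff (p : Fin n → ℝ) :
    ⊥ = A.flatAt p ↔ ∀ H ∈ A.hyperplanes, p ∉ H := by
  have key : ⊥ = A.flatAt p ↔ sInf {H ∈ A.hyperplanes | p ∈ H} = ⊤ := by
    constructor
    · exact fun h => (congrArg IntersectionPoset.flat h).symm
    · exact fun h => congrArg OrderDual.toDual (Subtype.ext h.symm)
  rw [key, sInf_eq_top]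
  constructor
  · intro h H hH hp
    obtain ⟨a, b, ha, rfl⟩ := A.isHyperplane H hH
    exact affineHyperplane_ne_top ha b (h _ ⟨hH, hp⟩)
  · exact fun h H hH => absurd hH.2 (h H hH.1)

open Classical in
/-- Möbius inversion: only the points off all hyperplanes survive when the point counts of the
flats are weighted by the Möbius function, because the flats through `p` form the interval from `⊥`
to `A.flatAt p`. -/
theorem sum_mu_mul_card_filter_mem (P : Finset (Fin n → ℝ)) :
    ∑ x : A.IntersectionPoset, IncidenceAlgebra.mu ℤ ⊥ x * ((P.filter (· ∈ x.flat)).card : ℤ) =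
      ((P.filter fun p => ∀ H ∈ A.hyperplanes, p ∉ H).card : ℤ) := by
  simp_rw [Finset.card_filter, Nat.cast_sum, Finset.mul_sum]
  rw [Finset.sum_comm]
  refine Finset.sum_congr rfl fun p _ => ?_
  have h : Finset.univ.filter (fun x : A.IntersectionPoset => p ∈ x.flat) =
      Finset.Icc ⊥ (A.flatAt p) := by
    ext x
    simp [le_flatAt_iff]
  simp only [Nat.cast_ite, Nat.cast_one, Nat.cast_zero, mul_ite, mul_one, mul_zero]
  rw [← Finset.sum_filter, h, IncidenceAlgebra.sum_Icc_mu_right]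
  simp only [bot_eq_flatAt_iff]

end HyperplaneArrangement

/-! ### Flats cut out by signed coordinate equations -/

/-- `W` is the image of a coordinate space under signed repetition of coordinates: the coordinates
in `J` are free, and every coordinate `x i` is `0` or `± x (ρ i)` with `ρ i ∈ J`, the coefficient
being `e i`. Where `e i = 0` the value `ρ i` is irrelevant. -/
def IsSignedCoordinateSet {ι : Type*} (J : Finset ι) (W : Set (ι → ℝ)) : Prop :=
  ∃ (ρ : ι → ι) (e : ι → ℝ), (∀ i, e i = 0 ∨ e i = 1 ∨ e i = -1) ∧ (∀ i, e i ≠ 0 → ρ i ∈ J) ∧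
    (∀ j ∈ J, ρ j = j ∧ e j = 1) ∧ ∀ x, x ∈ W ↔ ∀ i, x i = e i * x (ρ i)

namespace IsSignedCoordinateSet

variable {ι : Type*} {J : Finset ι} {W : Set (ι → ℝ)}

theorem univ [Fintype ι] :
    IsSignedCoordinateSet (Finset.univ : Finset ι) (Set.univ : Set (ι → ℝ)) :=
  ⟨id, fun _ => 1, by simp, by simp, by simp, by simp⟩

/-- Imposing an equation `x i + x j = 0` either changes nothing or eliminates a free coordinate, by
setting it to `0` or to `±` another free coordinate. -/
theorem exists_inter_sum_eq_zero [DecidableEq ι] (h : IsSignedCoordinateSet J W) (i j : ι) :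
    ∃ J', IsSignedCoordinateSet J' (W ∩ {x | x i + x j = 0}) := by
  obtain ⟨ρ, e, he, hJ, hρ, hW⟩ := h
  -- A free coordinate `x a` may be eliminated by an equation `x a = s * x b`.
  have elim : ∀ a ∈ J, ∀ (b : ι) (s : ℝ), (s = 0 ∨ s = 1 ∨ s = -1) → (s ≠ 0 → b ∈ J ∧ b ≠ a) →
      (∀ x ∈ W, x i + x j = 0 ↔ x a = s * x b) →
      ∃ J', IsSignedCoordinateSet J' (W ∩ {x | x i + x j = 0}) := by
    intro a ha b s hs hb hx
    refine ⟨J.erase a, fun i => if ρ i = a then b else ρ i,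
      fun i => if ρ i = a then e i * s else e i, fun i => ?_, fun i hi => ?_, fun c hc => ?_,
      fun x => ?_⟩
    · dsimp only
      split_ifs
      · rcases he i with h | h | h <;> rcases hs with h' | h' | h' <;> simp [h, h']
      · exact he i
    · dsimp only at hi ⊢
      split_ifs at hi ⊢ with h
      · have := hb (right_ne_zero_of_mul hi)
        exact Finset.mem_erase.2 ⟨this.2, this.1⟩
      · exact Finset.mem_erase.2 ⟨h, hJ i hi⟩
    · obtain ⟨hca, hc⟩ := Finset.mem_erase.1 hc
      simp [hρ c hc, hca]
    · have hax : ∀ (c : ι), x a = s * x b → (x c = e c * x (ρ c) ↔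
          x c = (if ρ c = a then e c * s else e c) * x (if ρ c = a then b else ρ c)) := by
        intro c h
        split_ifs with hc
        · rw [hc, h, mul_assoc]
        · rfl
      constructor
      · rintro ⟨hxW, hxij⟩
        have h := (hx x hxW).1 hxij
        exact fun c => (hax c h).1 ((hW x).1 hxW c)
      · intro h
        have h' : x a = s * x b := by
          have := h a
          simpa [hρ a ha] using this
        have hxW : x ∈ W := (hW x).2 fun c => (hax c h').2 (h c)
        exact ⟨hxW, (hx x hxW).2 h'⟩
  have triv : (∀ x ∈ W, x i + x j = 0) →
      ∃ J', IsSignedCoordinateSet J' (W ∩ {x | x i + x j = 0}) := by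
    intro h
    refine ⟨J, ρ, e, he, hJ, hρ, fun x => ?_⟩
    rw [← hW x]
    exact ⟨fun h => h.1, fun hx => ⟨hx, h x hx⟩⟩
  have hsum : ∀ x ∈ W, x i + x j = e i * x (ρ i) + e j * x (ρ j) := fun x hx => by
    rw [← (hW x).1 hx i, ← (hW x).1 hx j]
  by_cases hi : e i = 0
  · by_cases hj : e j = 0
    · exact triv fun x hx => by simp [hsum x hx, hi, hj]
    · exact elim (ρ j) (hJ j hj) i 0 (by simp) (by simp) fun x hx => by simp [hsum x hx, hi, hj]
  · by_cases hij : e j ≠ 0 ∧ ρ j = ρ i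
    · by_cases hs : e i + e j = 0
      · exact triv fun x hx => by rw [hsum x hx, hij.2, ← add_mul, hs, zero_mul]
      · exact elim (ρ i) (hJ i hi) i 0 (by simp) (by simp) fun x hx => by
          rw [hsum x hx, hij.2, ← add_mul]
          simp [hs]
    · refine elim (ρ i) (hJ i hi) (ρ j) (-(e i * e j)) ?_ (fun h => ?_) fun x hx => ?_
      · rcases he i with h | h | h <;> rcases he j with h' | h' | h' <;> simp [h, h']
      · have hj : e j ≠ 0 := fun h' => h (by simp [h'])
        exact ⟨hJ j hj, fun h' => hij ⟨hj, h'⟩⟩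
      · rw [hsum x hx]
        rcases he i with h | h | h
        · exact absurd h hi
        · rw [h]
          constructor <;> intro h' <;> linarith
        · rw [h]
          constructor <;> intro h' <;> linarith

/-- A signed coordinate set has `|B| ^ |J|` points with all coordinates in `B`, for every finite
set `B` of reals that contains `0` and is closed under negation. -/
theorem card_filter_mem [Fintype ι] [DecidableEq ι] [DecidablePred (· ∈ W)]
    (h : IsSignedCoordinateSet J W) {B : Finset ℝ} (h0 : 0 ∈ B) (hneg : ∀ b ∈ B, -b ∈ B) :
    ((Fintype.piFinset fun _ : ι => B).filter (· ∈ W)).card = B.card ^ J.card := by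
  obtain ⟨ρ, e, he, hJ, hρ, hW⟩ := h
  rw [← Fintype.card_coe J, ← Finset.card_univ, ← Finset.prod_const, ← Fintype.card_piFinset]
  refine Finset.card_bij' (fun x _ j => x j)
    (fun y _ i => if h : ρ i ∈ J then e i * y ⟨ρ i, h⟩ else 0) ?_ ?_ ?_ ?_
  · intro x hx
    simp only [Finset.mem_filter, Fintype.mem_piFinset] at hx ⊢
    exact fun j => hx.1 j
  · intro y hy
    simp only [Finset.mem_filter, Fintype.mem_piFinset] at hy ⊢
    refine ⟨fun i => ?_, (hW _).2 fun i => ?_⟩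
    · split_ifs with h
      · rcases he i with h' | h' | h' <;> simp [h', h0, hy, hneg]
      · exact h0
    · by_cases h : ρ i ∈ J
      · simp [h, hρ _ h]
      · have : e i = 0 := by_contra fun h' => h (hJ i h')
        simp only [h, dif_neg, not_false_eq_true, this, zero_mul]
  · intro x hx
    have hxW := (hW x).1 (Finset.mem_filter.1 hx).2
    funext i
    dsimp only
    split_ifs with h
    · exact (hxW i).symm
    · have : e i = 0 := by_contra fun h' => h (hJ i h')
      rw [hxW i, this, zero_mul]
  · intro y hy
    funext j
    simp [hρ j j.2]

theorem finrank_eq [Fintype ι] {V : Submodule ℝ (ι → ℝ)}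
    (h : IsSignedCoordinateSet J (V : Set (ι → ℝ))) : Module.finrank ℝ V = J.card := by
  classical
  obtain ⟨ρ, e, he, hJ, hρ, hW⟩ := h
  let f : V →ₗ[ℝ] (J → ℝ) := (LinearMap.funLeft ℝ ℝ ((↑) : J → ι)).comp V.subtype
  have hf : Function.Bijective f := by
    constructor
    · intro x y hxy
      ext i
      rw [(hW x).1 x.2 i, (hW y).1 y.2 i]
      by_cases hi : e i = 0
      · simp [hi]
      · have : f x ⟨ρ i, hJ i hi⟩ = f y ⟨ρ i, hJ i hi⟩ := by rw [hxy]
        exact congrArg (e i * ·) this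
    · intro y
      refine ⟨⟨fun i => if h : ρ i ∈ J then e i * y ⟨ρ i, h⟩ else 0, (hW _).2 fun i => ?_⟩, ?_⟩
      · by_cases h : ρ i ∈ J
        · simp [h, hρ _ h]
        · have : e i = 0 := by_contra fun h' => h (hJ i h')
          simp only [h, dif_neg, not_false_eq_true, this, zero_mul]
      · funext j
        simp [f, LinearMap.funLeft, hρ j j.2]
  rw [(LinearEquiv.ofBijective f hf).finrank_eq, Module.finrank_pi, Fintype.card_coe]

end IsSignedCoordinateSet

theorem exists_isSignedCoordinateSet_sInf {n : ℕ}
    {S : Set (AffineSubspace ℝ (Fin n → ℝ))} (hS : S ⊆ (thresholdArrangement n).hyperplanes) :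
    ∃ J, IsSignedCoordinateSet J ((sInf S : AffineSubspace ℝ (Fin n → ℝ)) : Set (Fin n → ℝ)) := by
  have hfin : S.Finite := (thresholdArrangement n).finite.subset hS
  induction S, hfin using Set.Finite.induction_on with
  | empty => exact ⟨Finset.univ, by simpa using IsSignedCoordinateSet.univ⟩
  | @insert H S _ _ ih =>
    obtain ⟨J, hJ⟩ := ih fun _ h => hS (Set.mem_insert_of_mem _ h)
    obtain ⟨i, j, -, rfl⟩ := hS (Set.mem_insert H S)
    obtain ⟨J', hJ'⟩ := hJ.exists_inter_sum_eq_zero i j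
    refine ⟨J', ?_⟩
    convert! hJ' using 1
    ext x
    rw [sInf_insert, SetLike.mem_coe, AffineSubspace.mem_inf_iff, mem_sumZeroHyperplane, and_comm]
    rfl

open Classical in
/-- A flat of dimension `d` of the threshold arrangement has `|B| ^ d` points in the cube `B ^ n`. -/
theorem card_filter_mem_flat {n : ℕ} (x : (thresholdArrangement n).IntersectionPoset)
    {B : Finset ℝ} (h0 : 0 ∈ B) (hneg : ∀ b ∈ B, -b ∈ B) :
    ((Fintype.piFinset fun _ : Fin n => B).filter (· ∈ x.flat)).card =
      B.card ^ Module.finrank ℝ x.flat.direction := by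
  obtain ⟨S, hS, hx⟩ := (OrderDual.ofDual x).2.2
  change x.flat = sInf S at hx
  obtain ⟨J, hJ⟩ := exists_isSignedCoordinateSet_sInf hS
  rw [← hx] at hJ
  have hzero : (0 : Fin n → ℝ) ∈ x.flat := by
    rw [hx, AffineSubspace.mem_sInf_iff]
    intro H hH
    obtain ⟨i, j, -, rfl⟩ := hS hH
    simp [mem_sumZeroHyperplane]
  have hdir : (x.flat.direction : Set (Fin n → ℝ)) = x.flat := by
    ext v
    simpa using (AffineSubspace.vadd_mem_iff_mem_direction v hzero).symm
  rw [IsSignedCoordinateSet.finrank_eq (J := J) (by rwa [hdir])]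
  exact hJ.card_filter_mem h0 hneg

open Classical in
/-- The characteristic polynomial at `|B|` counts the points of the cube `B ^ n` that lie on none of
the hyperplanes. -/
theorem eval_charPoly_thresholdArrangement (n : ℕ) {B : Finset ℝ} (h0 : 0 ∈ B)
    (hneg : ∀ b ∈ B, -b ∈ B) :
    (thresholdArrangement n).charPoly.eval (B.card : ℤ) =
      (((Fintype.piFinset fun _ : Fin n => B).filter
        fun f => ∀ i j, i ≠ j → f i + f j ≠ 0).card : ℤ) := by
  have := (thresholdArrangement n).sum_mu_mul_card_filter_mem (Fintype.piFinset fun _ => B)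
  simp only [card_filter_mem_flat _ h0 hneg] at this
  simp only [HyperplaneArrangement.charPoly, eval_finsetSum, eval_mul, eval_C, eval_pow, eval_X]
  push_cast at this
  rw [this]
  congr 2
  ext f
  simp only [Finset.mem_filter, and_congr_right_iff]
  intro _
  constructor
  · intro h i j hij
    rcases lt_or_gt_of_ne hij with hlt | hlt
    · exact fun h' => h _ ⟨i, j, hlt, rfl⟩ ((mem_sumZeroHyperplane i j f).2 h')
    · exact fun h' => h _ ⟨j, i, hlt, rfl⟩ ((mem_sumZeroHyperplane j i f).2 (by rwa [add_comm]))
  · rintro h _ ⟨i, j, hij, rfl⟩ hf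
    exact h i j hij.ne ((mem_sumZeroHyperplane i j f).1 hf)

/-! ### Counting tuples without opposite entries -/

/-- The `n`-tuples from `B` in which no two entries are opposite, where an entry is also compared
with itself, so that `0` does not occur. -/
noncomputable def antipodeFree (B : Finset ℝ) (n : ℕ) : Finset (Fin n → ℝ) :=
  {f ∈ Fintype.piFinset fun _ => B | ∀ i j, f i + f j ≠ 0}

theorem mem_antipodeFree {B : Finset ℝ} {n : ℕ} {f : Fin n → ℝ} :
    f ∈ antipodeFree B n ↔ (∀ i, f i ∈ B) ∧ ∀ i j, f i + f j ≠ 0 := by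
  simp [antipodeFree]

/-- An antipode-free tuple is an antipode-free tail preceded by a nonzero entry that is opposite to
no entry of the tail. -/
theorem sum_antipodeFree_succ (B : Finset ℝ) (n : ℕ) (w : (Fin (n + 1) → ℝ) → ℤ) :
    ∑ f ∈ antipodeFree B (n + 1), w f =
      ∑ g ∈ antipodeFree B n,
        ∑ b ∈ B.erase 0 \ (Finset.univ.image g).image Neg.neg, w (Fin.cons b g) := by
  rw [Finset.sum_sigma']
  refine Finset.sum_bij' (fun f _ => ⟨Fin.tail f, f 0⟩) (fun p _ => Fin.cons p.2 p.1) ?_ ?_ ?_ ?_ ?_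
  · intro f hf
    obtain ⟨hB, hf⟩ := mem_antipodeFree.1 hf
    simp only [Finset.mem_sigma, mem_antipodeFree, Finset.mem_sdiff, Finset.mem_erase,
      Finset.mem_image, Finset.mem_univ, true_and, Fin.tail]
    refine ⟨⟨fun i => hB _, fun i j => hf _ _⟩, ⟨fun h => hf 0 0 (by simp [h]), hB 0⟩, ?_⟩
    rintro ⟨_, ⟨i, rfl⟩, hi⟩
    exact hf 0 i.succ (by rw [← hi, neg_add_cancel])
  · rintro ⟨g, b⟩ h
    simp only [Finset.mem_sigma, mem_antipodeFree, Finset.mem_sdiff, Finset.mem_erase,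
      Finset.mem_image, Finset.mem_univ, true_and] at h
    obtain ⟨⟨hgB, hg⟩, ⟨hb0, hbB⟩, hbg⟩ := h
    have hne : ∀ i, b + g i ≠ 0 := fun i hi => hbg ⟨g i, ⟨i, rfl⟩, by linarith⟩
    refine mem_antipodeFree.2 ⟨fun i => ?_, fun i j => ?_⟩
    · refine Fin.cases ?_ (fun i => ?_) i
      · simpa using hbB
      · simpa using hgB i
    · refine Fin.cases ?_ (fun i => ?_) i <;> refine Fin.cases ?_ (fun j => ?_) j
      · simpa using hb0
      · simpa using hne j
      · simpa [add_comm] using hne i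
      · simpa using hg i j
  · intro f _
    simp
  · intro p _
    simp
  · intro f _
    simp

/-- Prepending an entry to an antipode-free tuple with `c` distinct entries either repeats one of
these, or uses one of the `2 * m - 2 * c` nonzero values that are neither an entry nor opposite to
one. -/
theorem sum_card_insert {B : Finset ℝ} {m n : ℕ} (hcard : B.card = 2 * m + 1) (h0 : 0 ∈ B)
    (hneg : ∀ b ∈ B, -b ∈ B) {g : Fin n → ℝ} (hg : g ∈ antipodeFree B n) (φ : ℕ → ℤ) :
    ∑ b ∈ B.erase 0 \ (Finset.univ.image g).image Neg.neg,
        φ (insert b (Finset.univ.image g)).card =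
      ((Finset.univ.image g).card : ℤ) * φ (Finset.univ.image g).card +
        (2 * m - 2 * ((Finset.univ.image g).card : ℤ)) * φ ((Finset.univ.image g).card + 1) := by
  obtain ⟨hgB, hg⟩ := mem_antipodeFree.1 hg
  have hC : ∀ b ∈ Finset.univ.image g, b ∈ B ∧ b ≠ 0 := by
    intro b hb
    obtain ⟨i, -, rfl⟩ := Finset.mem_image.1 hb
    exact ⟨hgB i, fun h => hg i i (by simp [h])⟩
  have hCC : ∀ b ∈ Finset.univ.image g, ∀ c ∈ Finset.univ.image g, -c ≠ b := by
    intro b hb c hc h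
    obtain ⟨i, -, rfl⟩ := Finset.mem_image.1 hb
    obtain ⟨j, -, rfl⟩ := Finset.mem_image.1 hc
    exact hg i j (by rw [← h, neg_add_cancel])
  generalize Finset.univ.image g = C at hC hCC ⊢
  have hsub : C ⊆ B.erase 0 \ C.image Neg.neg := by
    intro b hb
    simp only [Finset.mem_sdiff, Finset.mem_erase, Finset.mem_image, not_exists, not_and]
    exact ⟨⟨(hC b hb).2, (hC b hb).1⟩, hCC b hb⟩
  have hsub' : C.image Neg.neg ⊆ B.erase 0 := by
    intro b hb
    obtain ⟨c, hc, rfl⟩ := Finset.mem_image.1 hb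
    exact Finset.mem_erase.2 ⟨neg_ne_zero.2 (hC c hc).2, hneg c (hC c hc).1⟩
  have h1 := Finset.card_sdiff_add_card_eq_card hsub
  have h2 := Finset.card_sdiff_add_card_eq_card hsub'
  rw [Finset.card_image_of_injective _ neg_injective, Finset.card_erase_of_mem h0, hcard] at h2
  have h3 : (((B.erase 0 \ C.image Neg.neg) \ C).card : ℤ) = 2 * m - 2 * (C.card : ℤ) := by
    omega
  rw [← Finset.sum_sdiff hsub, ← h3, add_comm]
  congr 1
  · rw [Finset.sum_congr rfl fun b hb => by rw [Finset.insert_eq_of_mem hb], Finset.sum_const,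
      nsmul_eq_mul]
  · rw [Finset.sum_congr rfl fun b hb => by
      rw [Finset.card_insert_of_notMem (Finset.mem_sdiff.1 hb).2], Finset.sum_const, nsmul_eq_mul]

/-- There are `S(n, k) * ∏ i < k, (2 * m - 2 * i)` antipode-free `n`-tuples with `k` distinct
entries; the arbitrary weight `φ` records this number for all `k` at once. -/
theorem sum_antipodeFree_card_image {B : Finset ℝ} {m : ℕ} (hcard : B.card = 2 * m + 1)
    (h0 : 0 ∈ B) (hneg : ∀ b ∈ B, -b ∈ B) (n : ℕ) (φ : ℕ → ℤ) :
    ∑ f ∈ antipodeFree B n, φ (Finset.univ.image f).card =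
      ∑ k ∈ Finset.range (n + 1),
        (Nat.stirlingSecond n k : ℤ) * (∏ i ∈ Finset.range k, (2 * (m : ℤ) - 2 * i)) * φ k := by
  induction n generalizing φ with
  | zero =>
    have : antipodeFree B 0 = Finset.univ := by
      ext f
      rw [mem_antipodeFree]
      exact iff_of_true ⟨fun i => i.elim0, fun i => i.elim0⟩ (Finset.mem_univ f)
    simp [this]
  | succ n ih =>
    have himage : ∀ (b : ℝ) (g : Fin n → ℝ),
        Finset.univ.image (Fin.cons b g : Fin (n + 1) → ℝ) = insert b (Finset.univ.image g) := by
      intro b g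
      ext c
      simp [Fin.exists_fin_succ, eq_comm]
    rw [sum_antipodeFree_succ]
    simp_rw [himage]
    rw [Finset.sum_congr rfl fun g hg => sum_card_insert hcard h0 hneg hg φ,
      ih fun c => (c : ℤ) * φ c + (2 * m - 2 * (c : ℤ)) * φ (c + 1),
      Finset.sum_range_succ' _ (n + 1)]
    have hPk : ∀ k, ∏ i ∈ Finset.range (k + 1), (2 * (m : ℤ) - 2 * i) =
        (∏ i ∈ Finset.range k, (2 * (m : ℤ) - 2 * i)) * (2 * m - 2 * k) :=
      fun k => Finset.prod_range_succ _ _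
    obtain ⟨P, hP⟩ : ∃ P : ℕ → ℤ, ∀ k, ∏ i ∈ Finset.range k, (2 * (m : ℤ) - 2 * i) = P k :=
      ⟨_, fun _ => rfl⟩
    simp only [hP] at hPk ⊢
    have hshift : ∑ k ∈ Finset.range (n + 1), (Nat.stirlingSecond n k : ℤ) * P k * (k * φ k) =
        ∑ k ∈ Finset.range (n + 1), (Nat.stirlingSecond n (k + 1) : ℤ) * P (k + 1) *
          ((k + 1 : ℕ) * φ (k + 1)) := by
      have h := Finset.sum_range_succ'
        (fun k => (Nat.stirlingSecond n k : ℤ) * P k * (k * φ k)) (n + 1)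
      rw [Finset.sum_range_succ, Nat.stirlingSecond_eq_zero_of_lt (Nat.lt_succ_self n)] at h
      simpa using h
    simp_rw [mul_add]
    rw [Finset.sum_add_distrib, hshift, ← Finset.sum_add_distrib, Nat.stirlingSecond_succ_zero,
      Nat.cast_zero, zero_mul, zero_mul, add_zero]
    refine Finset.sum_congr rfl fun k _ => ?_
    rw [Nat.stirlingSecond_succ_succ, hPk]
    push_cast
    ring

theorem card_antipodeFree {B : Finset ℝ} {m : ℕ} (hcard : B.card = 2 * m + 1)
    (h0 : 0 ∈ B) (hneg : ∀ b ∈ B, -b ∈ B) (n : ℕ) :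
    ((antipodeFree B n).card : ℤ) = ∑ k ∈ Finset.range (n + 1),
      (Nat.stirlingSecond n k : ℤ) * ∏ i ∈ Finset.range k, (2 * (m : ℤ) - 2 * i) := by
  simpa using sum_antipodeFree_card_image hcard h0 hneg n fun _ => 1

theorem card_filter_apply_eq_zero {B : Finset ℝ} (h0 : 0 ∈ B) (n : ℕ) (p : Fin (n + 1)) :
    {f ∈ Fintype.piFinset fun _ : Fin (n + 1) => B |
      (∀ i j, i ≠ j → f i + f j ≠ 0) ∧ f p = 0}.card = (antipodeFree B n).card := by
  refine Finset.card_bij' (fun f _ => p.removeNth f)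
    (fun g _ => p.insertNth (α := fun _ => ℝ) 0 g) ?_ ?_ ?_ ?_
  · intro f hf
    simp only [Finset.mem_filter, Fintype.mem_piFinset] at hf
    obtain ⟨hB, hf, hp⟩ := hf
    refine mem_antipodeFree.2 ⟨fun i => hB _, fun i j h => ?_⟩
    -- For `i = j` the entry `f i` would be a second zero besides `f p`.
    by_cases hij : i = j
    · subst hij
      have hi : f (p.succAbove i) = 0 := by simpa [Fin.removeNth] using h
      exact hf _ _ (p.succAbove_ne i) (by rw [hi, hp, add_zero])
    · exact hf _ _ (fun h => hij (Fin.succAbove_right_injective h)) h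
  · intro g hg
    obtain ⟨hB, hg⟩ := mem_antipodeFree.1 hg
    have hne : ∀ i, g i ≠ 0 := fun i h => hg i i (by simp [h])
    simp only [Finset.mem_filter, Fintype.mem_piFinset, Fin.insertNth_apply_same, and_true]
    refine ⟨fun i => ?_, fun i j => ?_⟩
    · refine p.succAboveCases ?_ (fun i => ?_) i
      · simpa using h0
      · simpa using hB i
    · refine p.succAboveCases ?_ (fun i => ?_) i <;> refine p.succAboveCases ?_ (fun j => ?_) j
      · simp
      · simpa using hne j
      · simpa using hne i
      · simpa using fun _ => hg i j
  · intro f hf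
    simp only [Finset.mem_filter] at hf
    rw [← hf.2.2]
    simp
  · intro g _
    simp

/-- A tuple whose entries at distinct places are never opposite has at most one entry `0`: either it
is antipode-free, or deleting the entry `0` leaves an antipode-free tuple. -/
theorem card_filter_pairwise_add_ne_zero {B : Finset ℝ} (h0 : 0 ∈ B) (n : ℕ) :
    {f ∈ Fintype.piFinset fun _ : Fin (n + 1) => B | ∀ i j, i ≠ j → f i + f j ≠ 0}.card =
      (antipodeFree B (n + 1)).card + (n + 1) * (antipodeFree B n).card := by
  rw [← Finset.card_filter_add_card_filter_not (fun f => ∀ i, f i ≠ 0), Finset.filter_filter,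
    Finset.filter_filter]
  congr 1
  · congr 1
    ext f
    simp only [Finset.mem_filter, Fintype.mem_piFinset, mem_antipodeFree, and_congr_right_iff]
    intro _
    constructor
    · rintro ⟨h, hne⟩ i j
      by_cases hij : i = j
      · subst hij
        simpa using hne i
      · exact h i j hij
    · exact fun h => ⟨fun i j _ => h i j, fun i hi => h i i (by simp [hi])⟩
  · have hunion : {f ∈ Fintype.piFinset fun _ : Fin (n + 1) => B |
        (∀ i j, i ≠ j → f i + f j ≠ 0) ∧ ¬ ∀ i, f i ≠ 0} =
        Finset.univ.biUnion fun p => {f ∈ Fintype.piFinset fun _ : Fin (n + 1) => B |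
          (∀ i j, i ≠ j → f i + f j ≠ 0) ∧ f p = 0} := by
      ext f
      simp
    rw [hunion, Finset.card_biUnion]
    · simp [card_filter_apply_eq_zero h0]
    · intro p _ q _ hpq
      refine Finset.disjoint_left.2 fun f hf hf' => ?_
      have h := (Finset.mem_filter.1 hf).2
      exact h.1 p q hpq (by rw [h.2, (Finset.mem_filter.1 hf').2.2, add_zero])

/-! ### The characteristic polynomial -/

theorem exists_symmetric_finset (m : ℕ) :
    ∃ B : Finset ℝ, B.card = 2 * m + 1 ∧ 0 ∈ B ∧ ∀ b ∈ B, -b ∈ B := by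
  refine ⟨(Finset.Icc (-(m : ℤ)) m).image (fun z : ℤ => (z : ℝ)), ?_, ?_, ?_⟩
  · rw [Finset.card_image_of_injective _ Int.cast_injective, Int.card_Icc]
    omega
  · exact Finset.mem_image.2 ⟨0, by simp, by simp⟩
  · intro b hb
    obtain ⟨z, hz, rfl⟩ := Finset.mem_image.1 hb
    rw [Finset.mem_Icc] at hz
    exact Finset.mem_image.2 ⟨-z, Finset.mem_Icc.2 ⟨by omega, by omega⟩, by simp⟩

theorem proposition2p4 (n : ℕ) (hn : 2 ≤ n) :
    (thresholdArrangement n).charPoly =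
      ∑ k ∈ Finset.Icc 1 n,
        C ((Nat.stirlingSecond n k : ℤ) + (n : ℤ) * (Nat.stirlingSecond (n - 1) k : ℤ)) *
          ∏ i ∈ Finset.Icc 1 k, (X - C (2 * (i : ℤ) - 1)) := by
  obtain ⟨n, rfl⟩ : ∃ l, n = l + 1 := ⟨n - 1, by omega⟩
  refine eq_of_infinite_eval_eq _ _ (Set.Infinite.mono (s := Set.range fun m : ℕ =>
    ((2 * m + 1 : ℕ) : ℤ)) ?_ (Set.infinite_range_of_injective fun a b h => by
      simpa using h))
  rintro _ ⟨m, rfl⟩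
  obtain ⟨B, hcard, h0, hneg⟩ := exists_symmetric_finset m
  have hprod : ∀ k : ℕ, ∏ i ∈ Finset.Icc 1 k, ((2 * m + 1 : ℤ) - (2 * (i : ℤ) - 1)) =
      ∏ i ∈ Finset.range k, (2 * (m : ℤ) - 2 * i) := by
    intro k
    rw [← Finset.Ico_add_one_right_eq_Icc, Finset.prod_Ico_eq_prod_range, Nat.add_sub_cancel]
    refine Finset.prod_congr rfl fun i _ => ?_
    push_cast
    ring
  have hcount := eval_charPoly_thresholdArrangement (n + 1) h0 hneg
  rw [card_filter_pairwise_add_ne_zero h0, Nat.cast_add, Nat.cast_mul,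
    card_antipodeFree hcard h0 hneg, card_antipodeFree hcard h0 hneg, hcard] at hcount
  -- The second sum may be extended to `k = n + 1`, and both lose the term `k = 0`.
  have hext : ∀ g : ℕ → ℤ, ∑ k ∈ Finset.range (n + 1), (Nat.stirlingSecond n k : ℤ) * g k =
      ∑ k ∈ Finset.range (n + 1 + 1), (Nat.stirlingSecond n k : ℤ) * g k := by
    intro g
    rw [Finset.sum_range_succ _ (n + 1), Nat.stirlingSecond_eq_zero_of_lt (Nat.lt_succ_self n)]
    simp
  obtain ⟨l, rfl⟩ : ∃ l, n = l + 1 := ⟨n - 1, by omega⟩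
  rw [hext, Finset.mul_sum, ← Finset.sum_add_distrib, Finset.sum_range_succ'] at hcount
  simp only [Set.mem_ofPred_eq]
  rw [hcount, ← Finset.Ico_add_one_right_eq_Icc, Finset.sum_Ico_eq_sum_range, eval_finsetSum,
    Nat.stirlingSecond_succ_zero, Nat.stirlingSecond_succ_zero]
  simp only [Nat.cast_zero, zero_mul, mul_zero, add_zero, Nat.add_sub_cancel]
  refine Finset.sum_congr rfl fun k _ => ?_
  rw [add_comm 1 k, ← hprod]
  simp only [eval_mul, eval_C, eval_prod, eval_sub, eval_X]
  push_cast
  ring
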